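/- For an open set $E\subset\mathbb{R}^n$, call $E$ weakly $1$-convex (respectively, weakly $1$-semiconvex) if through every boundary point of $E$ there passes a straight line (respectively, a closed ray) that does not intersect $E$. Let $E^{\triangle}$ (respectively, $E^{\diamondsuit}$) denote the set of all points $x\in\mathbb{R}^n\setminus E$ such that every straight line (respectively, every closed ray) passing through $x$ intersects $E$. Let $n\geqslant 3$. Then: (1) there exists an open set $E\subset\mathbb{R}^n$ that is both weakly $1$-convex and weakly $1$-semiconvex, such that $E^{\diamondsuit}=E^{\triangle}$ and this set is non-empty, bounded, connected, and non-convex; (2) there exists an open set $E\subset\mathbb{R}^n$ that is both weakly $1$-convex and weakly $1$-semiconvex, such that $E^{\diamondsuit}=E^{\triangle}$ and this set is non-empty, unbounded, connected, and non-convex. -/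

import Mathlib

/-- The straight line through `y` with direction `α`. -/
def lineThrough {n : ℕ} (α y : EuclideanSpace ℝ (Fin n)) : Set (EuclideanSpace ℝ (Fin n)) :=
  {z | ∃ t : ℝ, z = t • α + y}

/-- The closed ray emanating from `y` with direction `α`. -/
def rayFrom {n : ℕ} (α y : EuclideanSpace ℝ (Fin n)) : Set (EuclideanSpace ℝ (Fin n)) :=
  {z | ∃ t : ℝ, 0 ≤ t ∧ z = t • α + y}

/-- `L` is a straight line (a 1-dimensional plane) of `ℝⁿ`. -/
def IsStraightLine {n : ℕ} (L : Set (EuclideanSpace ℝ (Fin n))) : Prop :=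
  ∃ α y : EuclideanSpace ℝ (Fin n), ‖α‖ = 1 ∧ L = lineThrough α y

/-- `L` is a closed ray (a 1-dimensional half-plane) of `ℝⁿ`. -/
def IsClosedRay {n : ℕ} (L : Set (EuclideanSpace ℝ (Fin n))) : Prop :=
  ∃ α y : EuclideanSpace ℝ (Fin n), ‖α‖ = 1 ∧ L = rayFrom α y

/-- Open weakly 1-convex sets: through every boundary point there passes a straight line
that does not intersect the set. -/
structure IsOpenWeaklyOneConvex {n : ℕ} (E : Set (EuclideanSpace ℝ (Fin n))) : Prop where
  isOpen : IsOpen E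
  exists_line : ∀ x ∈ frontier E, ∃ L, IsStraightLine L ∧ x ∈ L ∧ L ∩ E = ∅

/-- Open weakly 1-semiconvex sets: through every boundary point there passes a closed ray
that does not intersect the set. -/
structure IsOpenWeaklyOneSemiconvex {n : ℕ} (E : Set (EuclideanSpace ℝ (Fin n))) : Prop where
  isOpen : IsOpen E
  exists_ray : ∀ x ∈ frontier E, ∃ L, IsClosedRay L ∧ x ∈ L ∧ L ∩ E = ∅

/-- The 1-nonconvexity-point set `E^△`: the points outside `E` such that every straight line
passing through them intersects `E`. -/
def nonconvexityPoints {n : ℕ} (E : Set (EuclideanSpace ℝ (Fin n))) :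
    Set (EuclideanSpace ℝ (Fin n)) :=
  {x | x ∉ E ∧ ∀ L, IsStraightLine L → x ∈ L → (L ∩ E).Nonempty}

/-- The 1-nonsemiconvexity-point set `E^♦`: the points outside `E` such that every closed ray
passing through them intersects `E`. (Requiring this only of the rays emanating from the point
gives the same set, since every ray through a point contains a ray emanating from it.) -/
def nonsemiconvexityPoints {n : ℕ} (E : Set (EuclideanSpace ℝ (Fin n))) :
    Set (EuclideanSpace ℝ (Fin n)) :=
  {x | x ∉ E ∧ ∀ L, IsClosedRay L → x ∈ L → (L ∩ E).Nonempty}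

/-- The open members of the class `WC^n_1 ∖ C^n_1`: open weakly 1-convex sets with non-empty
1-nonconvexity-point set. -/
def openWCdiffC (n : ℕ) : Set (Set (EuclideanSpace ℝ (Fin n))) :=
  {E | IsOpenWeaklyOneConvex E ∧ (nonconvexityPoints E).Nonempty}

/-- The open members of the class `WS^n_1 ∖ S^n_1`: open weakly 1-semiconvex sets with non-empty
1-nonsemiconvexity-point set. -/
def openWSdiffS (n : ℕ) : Set (Set (EuclideanSpace ℝ (Fin n))) :=
  {E | IsOpenWeaklyOneSemiconvex E ∧ (nonsemiconvexityPoints E).Nonempty}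

/-! Take a prism along axis `k` whose cubical slice at height `s` has half-width `1 / (c - s)`. Let
`E` be the complement of this core with walls removed: the hyperplanes `|x k| = 1` and, within the
slab, the whole hypersurfaces `|x i| * (c - x k) = 1`, also where they run on beyond the core. Each
wall condition involves at most two coordinates, so for `n ≥ 3` a third axis direction gives a line
through any wall point that misses `E`. Every ray from a core point ends up in `E`. Hence both
exceptional sets equal the core. The width profile is strictly convex in `s`, so the core is not
convex; it is bounded for `c = 2` and unbounded for `c = 1`, where the width blows up as `s → 1`. -/

namespace TaperedPrism

variable {n : ℕ}

/-- The points `x` with `|x k| < 1` whose slice coordinates satisfy `|x i| < 1 / (c - x k)`. -/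
def core (k : Fin n) (c : ℝ) : Set (EuclideanSpace ℝ (Fin n)) :=
  {x | |x k| < 1 ∧ ∀ i ≠ k, |x i| * (c - x k) < 1}

/-- Everything outside the slab `|x k| ≤ 1`, together with the part of the open slab lying outside
the closed core and off the hypersurfaces `|x i| = 1 / (c - x k)` that bound it. -/
def outer (k : Fin n) (c : ℝ) : Set (EuclideanSpace ℝ (Fin n)) :=
  {x | 1 < |x k| ∨
    (|x k| < 1 ∧ (∃ i ≠ k, 1 < |x i| * (c - x k)) ∧ ∀ i ≠ k, |x i| * (c - x k) ≠ 1)}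

theorem isOpen_core (k : Fin n) (c : ℝ) : IsOpen (core k c) := by
  have h : core k c = {x : EuclideanSpace ℝ (Fin n) | |x k| < 1} ∩
      ⋂ i : Fin n, {x | i ≠ k → |x i| * (c - x k) < 1} := by
    ext x; simp [core]
  rw [h]
  refine (isOpen_lt (by fun_prop) (by fun_prop)).inter (isOpen_iInter_of_finite fun i => ?_)
  by_cases hi : i = k
  · simp [hi]
  · simpa [hi] using isOpen_lt (f := fun x : EuclideanSpace ℝ (Fin n) => |x i| * (c - x k))
      (g := fun _ => (1 : ℝ)) (by fun_prop) (by fun_prop)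

theorem isOpen_outer (k : Fin n) (c : ℝ) : IsOpen (outer k c) := by
  have h : outer k c = {x : EuclideanSpace ℝ (Fin n) | 1 < |x k|} ∪
      ({x | |x k| < 1} ∩ ((⋃ i : Fin n, {x | i ≠ k ∧ 1 < |x i| * (c - x k)}) ∩
        ⋂ i : Fin n, {x | i ≠ k → |x i| * (c - x k) ≠ 1})) := by
    ext x; simp [outer]
  rw [h]
  refine (isOpen_lt (by fun_prop) (by fun_prop)).union
    ((isOpen_lt (by fun_prop) (by fun_prop)).inter
      ((isOpen_iUnion fun i => ?_).inter (isOpen_iInter_of_finite fun i => ?_)))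
  · by_cases hi : i = k
    · simp [hi]
    · simpa [hi] using isOpen_lt (f := fun _ => (1 : ℝ))
        (g := fun x : EuclideanSpace ℝ (Fin n) => |x i| * (c - x k)) (by fun_prop) (by fun_prop)
  · by_cases hi : i = k
    · simp [hi]
    · simpa [hi] using isOpen_ne_fun (f := fun x : EuclideanSpace ℝ (Fin n) => |x i| * (c - x k))
        (g := fun _ => (1 : ℝ)) (by fun_prop) (by fun_prop)

theorem disjoint_core_outer (k : Fin n) (c : ℝ) : Disjoint (core k c) (outer k c) := by
  rw [Set.disjoint_left]
  rintro x ⟨hx, hlt⟩ (h | ⟨-, ⟨i, hi, h⟩, -⟩)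
  · exact lt_asymm hx h
  · exact lt_asymm (hlt i hi) h

/-- The complement of `core ∪ outer` is made of lines parallel to coordinate axes. -/
theorem exists_line_of_notMem (hn : 3 ≤ n) {k : Fin n} {c : ℝ} {x : EuclideanSpace ℝ (Fin n)}
    (hout : x ∉ outer k c) (hcore : x ∉ core k c) :
    ∃ α : EuclideanSpace ℝ (Fin n), ‖α‖ = 1 ∧ ∀ t : ℝ, t • α + x ∉ outer k c := by
  have key : |x k| = 1 ∨ ∃ i ≠ k, |x i| * (c - x k) = 1 := by
    by_contra! hcon
    obtain ⟨hk, hne⟩ := hcon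
    rcases lt_or_gt_of_ne hk with h | h
    · refine hout (Or.inr ⟨h, ?_, hne⟩)
      by_contra! hle
      exact hcore ⟨h, fun i hi => lt_of_le_of_ne (hle i hi) (hne i hi)⟩
    · exact hout (Or.inl h)
  -- The only place where the dimension matters: moving along axis `j` changes neither coordinate in
  -- the wall equation.
  have avoid (i : Fin n) : ∃ j : Fin n, j ≠ k ∧ j ≠ i := by
    obtain ⟨j, hj⟩ := Finset.exists_mem_notMem_of_card_lt_card
      (s := {k, i}) (t := (Finset.univ : Finset (Fin n)))
      (lt_of_le_of_lt Finset.card_le_two (by simpa using Nat.lt_of_succ_le hn))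
    exact ⟨j, by aesop⟩
  rcases key with h | ⟨i, hi, h⟩
  · obtain ⟨j, hjk, -⟩ := avoid k
    refine ⟨EuclideanSpace.single j 1, by simp, fun t ht => ?_⟩
    simp [outer, hjk.symm, h] at ht
  · obtain ⟨j, hjk, hji⟩ := avoid i
    refine ⟨EuclideanSpace.single j 1, by simp, ?_⟩
    rintro t (ht | ⟨-, -, ht⟩)
    · have hx : ¬ 1 < |x k| := fun h' => hout (Or.inl h')
      simp [hjk.symm] at ht
      exact hx ht
    · exact ht i hi (by simpa [hjk.symm, hji.symm] using h)

theorem eventually_lt_abs_affine {a : ℝ} (ha : a ≠ 0) (b M : ℝ) :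
    ∀ᶠ t : ℝ in Filter.atTop, M < |t * a + b| := by
  have h : Filter.Tendsto (fun t : ℝ => |t * a + b|) Filter.atTop Filter.atTop := by
    rcases lt_or_gt_of_ne ha with h | h
    · exact Filter.tendsto_abs_atBot_atTop.comp
        (Filter.tendsto_atBot_add_const_right _ b (Filter.tendsto_id.atTop_mul_const_of_neg h))
    · exact Filter.tendsto_abs_atTop_atTop.comp
        (Filter.tendsto_atTop_add_const_right _ b (Filter.tendsto_id.atTop_mul_const h))
  exact h.eventually_gt_atTop M

/-- A line through a point of the core eventually enters `outer` for good. -/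
theorem eventually_mem_outer {k : Fin n} {c : ℝ} (hc : 1 ≤ c) {α x : EuclideanSpace ℝ (Fin n)}
    (hα : α ≠ 0) (hx : x ∈ core k c) : ∀ᶠ t : ℝ in Filter.atTop, t • α + x ∈ outer k c := by
  by_cases hk : α k = 0
  · have hpos : 0 < c - x k := by linarith [(abs_lt.1 hx.1).2]
    have hall : ∀ᶠ t : ℝ in Filter.atTop, ∀ i : Fin n, α i ≠ 0 →
        (c - x k)⁻¹ < |t * α i + x i| := by
      rw [Filter.eventually_all]
      intro i
      by_cases hi : α i = 0
      · simp [hi]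
      · filter_upwards [eventually_lt_abs_affine hi (x i) (c - x k)⁻¹] with t ht _ using ht
    obtain ⟨j, hj⟩ : ∃ j, α j ≠ 0 := by
      by_contra! h
      exact hα (by ext i; simpa using h i)
    have hlarge {s : ℝ} (hs : (c - x k)⁻¹ < s) : 1 < s * (c - x k) := by
      rwa [inv_eq_one_div, div_lt_iff₀ hpos] at hs
    filter_upwards [hall] with t ht
    -- The line stays in one slice: moving coordinates end beyond the walls, and fixed ones stay
    -- strictly inside, so none lies on a wall.
    refine Or.inr ⟨by simpa [hk] using hx.1, ⟨j, ?_, ?_⟩, fun i hi => ?_⟩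
    · rintro rfl
      exact hj hk
    · simpa [hk] using hlarge (ht j hj)
    · by_cases hi0 : α i = 0
      · simpa [hk, hi0] using (hx.2 i hi).ne
      · simpa [hk] using (hlarge (ht i hi0)).ne'
  · filter_upwards [eventually_lt_abs_affine hk (x k) 1] with t ht
    exact Or.inl (by simpa using ht)

theorem core_subset_nonsemiconvexityPoints (k : Fin n) {c : ℝ} (hc : 1 ≤ c) :
    core k c ⊆ nonsemiconvexityPoints (outer k c) := by
  refine fun x hx => ⟨Set.disjoint_left.1 (disjoint_core_outer k c) hx, ?_⟩
  rintro _ ⟨α, y, hα, rfl⟩ ⟨t₀, ht₀, rfl⟩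
  have hα0 : α ≠ 0 := by
    rintro rfl
    simp at hα
  obtain ⟨t, ht, hmem⟩ :=
    ((Filter.eventually_ge_atTop 0).and (eventually_mem_outer hc hα0 hx)).exists
  -- The ray may start before `x`; only its part beyond `x` is used.
  exact ⟨_, ⟨t + t₀, by positivity, by rw [add_smul, add_assoc]⟩, hmem⟩

end TaperedPrism

theorem nonsemiconvexityPoints_subset_nonconvexityPoints {n : ℕ}
    (E : Set (EuclideanSpace ℝ (Fin n))) : nonsemiconvexityPoints E ⊆ nonconvexityPoints E := by
  rintro x ⟨hx, h⟩
  refine ⟨hx, ?_⟩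
  rintro _ ⟨α, y, hα, rfl⟩ ⟨t₀, rfl⟩
  obtain ⟨_, ⟨t, -, rfl⟩, hE⟩ :=
    h (rayFrom α (t₀ • α + y)) ⟨α, _, hα, rfl⟩ ⟨0, le_rfl, by simp⟩
  exact ⟨_, ⟨t + t₀, by rw [add_smul, add_assoc]⟩, hE⟩

namespace TaperedPrism

variable {n : ℕ}

theorem nonconvexityPoints_subset_core (hn : 3 ≤ n) (k : Fin n) (c : ℝ) :
    nonconvexityPoints (outer k c) ⊆ core k c := by
  rintro x ⟨hx, h⟩
  by_contra hcore
  obtain ⟨α, hα, hline⟩ := exists_line_of_notMem hn hx hcore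
  obtain ⟨_, ⟨t, rfl⟩, ht⟩ := h (lineThrough α x) ⟨α, x, hα, rfl⟩ ⟨0, by simp⟩
  exact hline t ht

theorem nonconvexityPoints_outer (hn : 3 ≤ n) (k : Fin n) {c : ℝ} (hc : 1 ≤ c) :
    nonconvexityPoints (outer k c) = core k c :=
  (nonconvexityPoints_subset_core hn k c).antisymm
    ((core_subset_nonsemiconvexityPoints k hc).trans
      (nonsemiconvexityPoints_subset_nonconvexityPoints _))

theorem nonsemiconvexityPoints_outer (hn : 3 ≤ n) (k : Fin n) {c : ℝ} (hc : 1 ≤ c) :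
    nonsemiconvexityPoints (outer k c) = core k c :=
  ((nonsemiconvexityPoints_subset_nonconvexityPoints _).trans
    (nonconvexityPoints_subset_core hn k c)).antisymm (core_subset_nonsemiconvexityPoints k hc)

theorem exists_line_of_mem_frontier (hn : 3 ≤ n) {k : Fin n} {c : ℝ}
    {x : EuclideanSpace ℝ (Fin n)} (hx : x ∈ frontier (outer k c)) :
    ∃ α : EuclideanSpace ℝ (Fin n), ‖α‖ = 1 ∧ ∀ t : ℝ, t • α + x ∉ outer k c := by
  rw [(isOpen_outer k c).frontier_eq] at hx
  -- The core is open and disjoint from `outer`, so it misses the closure as well: boundary points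
  -- lie on walls.
  exact exists_line_of_notMem hn hx.2 fun hcore =>
    Set.disjoint_left.1 ((disjoint_core_outer k c).closure_right (isOpen_core k c)) hcore hx.1

theorem isOpenWeaklyOneConvex_outer (hn : 3 ≤ n) (k : Fin n) (c : ℝ) :
    IsOpenWeaklyOneConvex (outer k c) := by
  refine ⟨isOpen_outer k c, fun x hx => ?_⟩
  obtain ⟨α, hα, hline⟩ := exists_line_of_mem_frontier hn hx
  refine ⟨lineThrough α x, ⟨α, x, hα, rfl⟩, ⟨0, by simp⟩, ?_⟩
  rw [Set.eq_empty_iff_forall_notMem]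
  rintro _ ⟨⟨t, rfl⟩, ht⟩
  exact hline t ht

theorem isOpenWeaklyOneSemiconvex_outer (hn : 3 ≤ n) (k : Fin n) (c : ℝ) :
    IsOpenWeaklyOneSemiconvex (outer k c) := by
  refine ⟨isOpen_outer k c, fun x hx => ?_⟩
  obtain ⟨α, hα, hline⟩ := exists_line_of_mem_frontier hn hx
  refine ⟨rayFrom α x, ⟨α, x, hα, rfl⟩, ⟨0, le_rfl, by simp⟩, ?_⟩
  rw [Set.eq_empty_iff_forall_notMem]
  rintro _ ⟨⟨t, -, rfl⟩, ht⟩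
  exact hline t ht

/-! ### Shape of the core: connectedness, boundedness, non-convexity. -/

theorem isConnected_core (k : Fin n) {c : ℝ} (hc : 1 ≤ c) : IsConnected (core k c) := by
  -- Rescaling each slice presents the core as a continuous image of an open cube.
  let f : (Fin n → ℝ) → EuclideanSpace ℝ (Fin n) := fun u =>
    WithLp.toLp 2 fun i => if i = k then u i else u i / (c - u k)
  let S : Set (Fin n → ℝ) := Set.univ.pi fun _ => Set.Ioo (-1) 1
  have hpos {s : ℝ} (hs : |s| < 1) : 0 < c - s := by linarith [(abs_lt.1 hs).2]
  have hmem {u : Fin n → ℝ} : u ∈ S ↔ ∀ i, |u i| < 1 := by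
    simp [S, abs_lt]
  have himage : core k c = f '' S := by
    ext x
    constructor
    · rintro ⟨hk, hx⟩
      have hp := hpos hk
      refine ⟨fun i => if i = k then x i else x i * (c - x k), hmem.2 fun i => ?_, ?_⟩
      · by_cases hi : i = k
        · simpa [hi] using hk
        · simpa [hi, abs_mul, abs_of_pos hp] using hx i hi
      · ext i
        by_cases hi : i = k
        · simp [f, hi]
        · simp [f, hi, hp.ne']
    · rintro ⟨u, hu, rfl⟩
      have hp := hpos (hmem.1 hu k)
      refine ⟨by simpa [f] using hmem.1 hu k, fun i hi => ?_⟩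
      simpa [f, hi, abs_div, abs_of_pos hp, hp.ne'] using hmem.1 hu i
  have hcont : ContinuousOn f S := by
    refine (PiLp.continuous_toLp 2 _).comp_continuousOn (continuousOn_pi.2 fun i => ?_)
    by_cases hi : i = k
    · simp only [hi, if_true]
      fun_prop
    · simp only [hi, if_false]
      exact ContinuousOn.div (by fun_prop) (by fun_prop) fun u hu => (hpos (hmem.1 hu k)).ne'
  have hS : Convex ℝ S := convex_pi fun _ _ => convex_Ioo _ _
  rw [himage]
  exact IsConnected.image ⟨⟨0, hmem.2 (by simp)⟩, hS.isPreconnected⟩ f hcont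

theorem isBounded_core (k : Fin n) {c : ℝ} (hc : 2 ≤ c) : Bornology.IsBounded (core k c) := by
  have h : (PiLp.homeomorph 2 fun _ : Fin n => ℝ) ⁻¹' Set.univ.pi (fun _ => Set.Icc (-1) 1)
      ⊇ core k c := by
    rintro x ⟨hk, hx⟩ i -
    refine abs_le.1 (show |x i| ≤ 1 from ?_)
    by_cases hi : i = k
    · exact hi ▸ hk.le
    -- Since `c ≥ 2`, the factor `c - x k` exceeds `1`.
    · nlinarith [hx i hi, abs_nonneg (x i), (abs_lt.1 hk).2]
  refine Bornology.IsBounded.subset (IsCompact.isBounded ?_) h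
  exact (Homeomorph.isCompact_preimage _).2 (isCompact_univ_pi fun _ => isCompact_Icc)

/-- The point with coordinates `p` at `k`, `a` at `j`, and zero elsewhere. -/
noncomputable def planePoint (k j : Fin n) (p a : ℝ) : EuclideanSpace ℝ (Fin n) :=
  EuclideanSpace.single k p + EuclideanSpace.single j a

theorem planePoint_mem_core {k j : Fin n} (hj : j ≠ k) {c p a : ℝ} :
    planePoint k j p a ∈ core k c ↔ |p| < 1 ∧ |a| * (c - p) < 1 := by
  have hk : planePoint k j p a k = p := by simp [planePoint, hj.symm]
  have hja : planePoint k j p a j = a := by simp [planePoint, hj]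
  constructor
  · rintro ⟨h₁, h₂⟩
    exact ⟨hk ▸ h₁, by simpa only [hk, hja] using h₂ j hj⟩
  · rintro ⟨h₁, h₂⟩
    refine ⟨hk.symm ▸ h₁, fun i hi => ?_⟩
    by_cases hij : i = j
    · rw [hij, hk, hja]
      exact h₂
    · simp [planePoint, hi, hij]

theorem not_convex_core {k j : Fin n} (hj : j ≠ k) {c p q a b : ℝ} (hp : |p| < 1) (hq : |q| < 1)
    (ha : |a| * (c - p) < 1) (hb : |b| * (c - q) < 1)
    (hab : 1 ≤ |(a + b) / 2| * (c - (p + q) / 2)) : ¬ Convex ℝ (core k c) := by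
  intro h
  have hmid := h.midpoint_mem ((planePoint_mem_core hj).2 ⟨hp, ha⟩)
    ((planePoint_mem_core hj).2 ⟨hq, hb⟩)
  have heq : midpoint ℝ (planePoint k j p a) (planePoint k j q b) =
      planePoint k j ((p + q) / 2) ((a + b) / 2) := by
    ext i
    simp only [midpoint_eq_smul_add, planePoint, PiLp.smul_apply, PiLp.add_apply,
      PiLp.single_apply, smul_eq_mul, invOf_eq_inv]
    split_ifs <;> ring
  rw [heq, planePoint_mem_core hj] at hmid
  exact hab.not_gt hmid.2

theorem not_isBounded_core_one {k j : Fin n} (hj : j ≠ k) :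
    ¬ Bornology.IsBounded (core k 1) := by
  intro h
  obtain ⟨R, hR, hbound⟩ := h.exists_pos_norm_le
  -- At this height the half-width is `R + 2`, leaving room for a coordinate `R + 1`.
  have hmem : planePoint k j (1 - 1 / (R + 2)) (R + 1) ∈ core k 1 := by
    rw [planePoint_mem_core hj, abs_of_pos (by positivity : 0 < R + 1)]
    have h₁ : 0 < 1 / (R + 2) := by positivity
    have h₂ : 1 / (R + 2) < 1 := by
      rw [div_lt_one (by positivity)]
      linarith
    refine ⟨abs_lt.2 ⟨by linarith, by linarith⟩, ?_⟩
    rw [sub_sub_cancel, mul_one_div, div_lt_one (by positivity)]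
    linarith
  have hcoord := (PiLp.norm_apply_le _ j).trans (hbound _ hmem)
  have hle : R + 1 ≤ R := by
    simpa [planePoint, hj, abs_of_pos (by positivity : 0 < R + 1)] using hcoord
  linarith

theorem outer_mem_inter (hn : 3 ≤ n) (k : Fin n) {c : ℝ} (hc : 1 ≤ c) :
    outer k c ∈ openWSdiffS n ∩ openWCdiffC n := by
  refine ⟨⟨isOpenWeaklyOneSemiconvex_outer hn k c, ?_⟩, isOpenWeaklyOneConvex_outer hn k c, ?_⟩
  · exact nonsemiconvexityPoints_outer hn k hc ▸ (isConnected_core k hc).nonempty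
  · exact nonconvexityPoints_outer hn k hc ▸ (isConnected_core k hc).nonempty

end TaperedPrism

open TaperedPrism

theorem mainTheorem5 (n : ℕ) (hn : 3 ≤ n) :
    (∃ E : Set (EuclideanSpace ℝ (Fin n)),
      E ∈ openWSdiffS n ∩ openWCdiffC n ∧
      nonsemiconvexityPoints E = nonconvexityPoints E ∧
      Bornology.IsBounded (nonconvexityPoints E) ∧
      IsConnected (nonconvexityPoints E) ∧
      ¬ Convex ℝ (nonconvexityPoints E)) ∧
    (∃ E : Set (EuclideanSpace ℝ (Fin n)),
      E ∈ openWSdiffS n ∩ openWCdiffC n ∧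
      nonsemiconvexityPoints E = nonconvexityPoints E ∧
      ¬ Bornology.IsBounded (nonconvexityPoints E) ∧
      IsConnected (nonconvexityPoints E) ∧
      ¬ Convex ℝ (nonconvexityPoints E)) := by
  let k : Fin n := ⟨0, by lia⟩
  let j : Fin n := ⟨1, by lia⟩
  have hj : j ≠ k := by simp [j, k]
  refine ⟨⟨outer k 2, outer_mem_inter hn k one_le_two, ?_⟩,
    ⟨outer k 1, outer_mem_inter hn k le_rfl, ?_⟩⟩
  · rw [nonsemiconvexityPoints_outer hn k one_le_two, nonconvexityPoints_outer hn k one_le_two]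
    -- The endpoints give `0.99` and `0.87`, both below `1`; their midpoint, at height `0`, gives
    -- `1.2`.
    refine ⟨rfl, isBounded_core k le_rfl, isConnected_core k one_le_two,
      not_convex_core hj (p := 9 / 10) (q := -9 / 10) (a := 9 / 10) (b := 3 / 10) ?_ ?_ ?_ ?_ ?_⟩
    all_goals norm_num [abs_of_pos, abs_of_neg, abs_lt]
  · rw [nonsemiconvexityPoints_outer hn k le_rfl, nonconvexityPoints_outer hn k le_rfl]
    refine ⟨rfl, not_isBounded_core_one hj, isConnected_core k le_rfl,
      not_convex_core hj (p := 9 / 10) (q := -9 / 10) (a := 9) (b := 0) ?_ ?_ ?_ ?_ ?_⟩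
    all_goals norm_num [abs_of_pos, abs_of_neg, abs_lt]
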